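/- A \emph{$C^\infty$-ring} is a set $A$ together with, for every $n\in\mathbb N$ (including $n=0$) and every smooth function $f:\mathbb R^n\to\mathbb R$, an operation $f^A:A^n\to A$, such that the $k$-th projection $\mathbb R^n\to\mathbb R$ is interpreted as the $k$-th projection $A^n\to A$, and $(h\circ(g_1,\dots,g_n))^A=h^A\circ(g_1^A,\dots,g_n^A)$ for all smooth $h:\mathbb R^n\to\mathbb R$ and $g_1,\dots,g_n:\mathbb R^m\to\mathbb R$. Every $C^\infty$-ring is regarded as a commutative unital ring through the interpretations of addition, multiplication, negation and the constants $0,1$. A \emph{$C^\infty$-field} is a $C^\infty$-ring whose underlying ring is a field. For a commutative ring $A$, let $\sum A^2$ denote the set of all finite sums of squares of elements of $A$, and $A^\times$ its group of units. \textbf{Corollary.} Every $C^\infty$-ring $A$ has the weak bounded inversion property, that is, $1+\sum A^2\subseteq A^\times$. In particular, every $C^\infty$-field $F$ is formally real, that is, $-1\notin\sum F^2$. -/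

import Mathlib

open scoped ContDiff

universe u

/-- `C^∞(ℝⁿ, ℝ)`: the smooth real functions of `n` variables (`n = 0` gives the constants). -/
abbrev SmoothFun (n : ℕ) : Type :=
  {f : (Fin n → ℝ) → ℝ // ContDiff ℝ ∞ f}

namespace SmoothFun

/-- The `k`-th projection `ℝⁿ → ℝ`. -/
def proj {n : ℕ} (k : Fin n) : SmoothFun n :=
  ⟨fun x => x k, by fun_prop⟩

/-- The composite `h ∘ (g₁, …, gₙ) : ℝᵐ → ℝ`. -/
def comp {m n : ℕ} (h : SmoothFun n) (g : Fin n → SmoothFun m) : SmoothFun m :=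
  ⟨fun x => h.1 (fun i => (g i).1 x), h.2.comp (contDiff_pi.2 fun i => (g i).2)⟩

/-- Addition `ℝ² → ℝ`. -/
def add : SmoothFun 2 := ⟨fun x => x 0 + x 1, by fun_prop⟩

/-- Multiplication `ℝ² → ℝ`. -/
def mul : SmoothFun 2 := ⟨fun x => x 0 * x 1, by fun_prop⟩

/-- Negation `ℝ¹ → ℝ`. -/
def neg : SmoothFun 1 := ⟨fun x => -x 0, by fun_prop⟩

/-- The constant `c`, as a function of no variables. -/
def const (c : ℝ) : SmoothFun 0 := ⟨fun _ => c, contDiff_const⟩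

end SmoothFun

/-- A `C^∞`-ring: a set `A` on which every smooth function `ℝⁿ → ℝ` acts as an `n`-ary operation,
in such a way that projections act as projections and all composites are respected. -/
class CInftyRing (A : Type u) where
  /-- The interpretation `f^A : Aⁿ → A` of a smooth function `f : ℝⁿ → ℝ`. -/
  op : ∀ {n : ℕ}, SmoothFun n → (Fin n → A) → A
  op_proj : ∀ {n : ℕ} (k : Fin n) (a : Fin n → A), op (SmoothFun.proj k) a = a k
  op_comp : ∀ {m n : ℕ} (h : SmoothFun n) (g : Fin n → SmoothFun m) (a : Fin m → A),
    op (SmoothFun.comp h g) a = op h (fun i => op (g i) a)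

namespace CInftyRing

variable {A : Type u} [CInftyRing A]

/-! The operations of the underlying ring are the interpretations of those of `ℝ`. -/

instance : Add A := ⟨fun a b => op SmoothFun.add ![a, b]⟩
instance : Mul A := ⟨fun a b => op SmoothFun.mul ![a, b]⟩
instance : Neg A := ⟨fun a => op SmoothFun.neg ![a]⟩
instance : Zero A := ⟨op (SmoothFun.const 0) ![]⟩
instance : One A := ⟨op (SmoothFun.const 1) ![]⟩

theorem op_add {n : ℕ} (f g : SmoothFun n) (v : Fin n → A) :
    op f v + op g v = op (⟨fun x => f.1 x + g.1 x, f.2.add g.2⟩ : SmoothFun n) v := by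
  have h := op_comp SmoothFun.add ![f, g] v
  have e : (fun i => op (![f, g] i) v) = ![op f v, op g v] := by
    funext i; fin_cases i <;> rfl
  rw [e] at h
  exact h.symm

theorem op_mul {n : ℕ} (f g : SmoothFun n) (v : Fin n → A) :
    op f v * op g v = op (⟨fun x => f.1 x * g.1 x, f.2.mul g.2⟩ : SmoothFun n) v := by
  have h := op_comp SmoothFun.mul ![f, g] v
  have e : (fun i => op (![f, g] i) v) = ![op f v, op g v] := by
    funext i; fin_cases i <;> rfl
  rw [e] at h
  exact h.symm

theorem op_neg {n : ℕ} (f : SmoothFun n) (v : Fin n → A) :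
    -op f v = op (⟨fun x => -f.1 x, f.2.neg⟩ : SmoothFun n) v := by
  have h := op_comp SmoothFun.neg ![f] v
  have e : (fun i => op (![f] i) v) = ![op f v] := by
    funext i; fin_cases i; rfl
  rw [e] at h
  exact h.symm

theorem op_zero {n : ℕ} (v : Fin n → A) :
    (0 : A) = op (⟨fun _ => 0, contDiff_const⟩ : SmoothFun n) v := by
  have h := op_comp (SmoothFun.const 0) ![] v
  rw [Subsingleton.elim (fun i => op ((![] : Fin 0 → SmoothFun n) i) v) ![]] at h
  exact h.symm

theorem op_one {n : ℕ} (v : Fin n → A) :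
    (1 : A) = op (⟨fun _ => 1, contDiff_const⟩ : SmoothFun n) v := by
  have h := op_comp (SmoothFun.const 1) ![] v
  rw [Subsingleton.elim (fun i => op ((![] : Fin 0 → SmoothFun n) i) v) ![]] at h
  exact h.symm

theorem add_assoc' (a b c : A) : a + b + c = a + (b + c) := by
  have ha : a = op (SmoothFun.proj 0) ![a, b, c] := by rw [op_proj]; rfl
  have hb : b = op (SmoothFun.proj 1) ![a, b, c] := by rw [op_proj]; rfl
  have hc : c = op (SmoothFun.proj 2) ![a, b, c] := by rw [op_proj]; rfl
  generalize ![a, b, c] = v at ha hb hc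
  subst ha hb hc
  simp only [op_add, add_assoc]

theorem mul_assoc' (a b c : A) : a * b * c = a * (b * c) := by
  have ha : a = op (SmoothFun.proj 0) ![a, b, c] := by rw [op_proj]; rfl
  have hb : b = op (SmoothFun.proj 1) ![a, b, c] := by rw [op_proj]; rfl
  have hc : c = op (SmoothFun.proj 2) ![a, b, c] := by rw [op_proj]; rfl
  generalize ![a, b, c] = v at ha hb hc
  subst ha hb hc
  simp only [op_mul, mul_assoc]

theorem left_distrib' (a b c : A) : a * (b + c) = a * b + a * c := by
  have ha : a = op (SmoothFun.proj 0) ![a, b, c] := by rw [op_proj]; rfl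
  have hb : b = op (SmoothFun.proj 1) ![a, b, c] := by rw [op_proj]; rfl
  have hc : c = op (SmoothFun.proj 2) ![a, b, c] := by rw [op_proj]; rfl
  generalize ![a, b, c] = v at ha hb hc
  subst ha hb hc
  simp only [op_mul, op_add, mul_add]

theorem add_comm' (a b : A) : a + b = b + a := by
  have ha : a = op (SmoothFun.proj 0) ![a, b] := by rw [op_proj]; rfl
  have hb : b = op (SmoothFun.proj 1) ![a, b] := by rw [op_proj]; rfl
  generalize ![a, b] = v at ha hb
  subst ha hb
  rw [op_add, op_add]
  simp only [add_comm]

theorem mul_comm' (a b : A) : a * b = b * a := by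
  have ha : a = op (SmoothFun.proj 0) ![a, b] := by rw [op_proj]; rfl
  have hb : b = op (SmoothFun.proj 1) ![a, b] := by rw [op_proj]; rfl
  generalize ![a, b] = v at ha hb
  subst ha hb
  rw [op_mul, op_mul]
  simp only [mul_comm]

theorem zero_add' (a : A) : 0 + a = a := by
  have ha : a = op (SmoothFun.proj 0) ![a] := by rw [op_proj]; rfl
  generalize ![a] = v at ha
  subst ha
  rw [op_zero v, op_add]
  simp only [zero_add]

theorem zero_mul' (a : A) : 0 * a = 0 := by
  have ha : a = op (SmoothFun.proj 0) ![a] := by rw [op_proj]; rfl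
  generalize ![a] = v at ha
  subst ha
  rw [op_zero v, op_mul]
  simp only [zero_mul]

theorem one_mul' (a : A) : 1 * a = a := by
  have ha : a = op (SmoothFun.proj 0) ![a] := by rw [op_proj]; rfl
  generalize ![a] = v at ha
  subst ha
  rw [op_one v, op_mul]
  simp only [one_mul]

theorem neg_add_cancel' (a : A) : -a + a = 0 := by
  have ha : a = op (SmoothFun.proj 0) ![a] := by rw [op_proj]; rfl
  generalize ![a] = v at ha
  subst ha
  rw [op_zero v, op_neg, op_add]
  simp only [neg_add_cancel]

/-- The underlying commutative ring of a `C^∞`-ring. -/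
instance : CommRing A where
  add_assoc := add_assoc'
  zero_add := zero_add'
  add_zero a := (add_comm' a 0).trans (zero_add' a)
  nsmul := nsmulRec
  add_comm := add_comm'
  left_distrib := left_distrib'
  right_distrib a b c := by
    rw [mul_comm' (a + b) c, left_distrib', mul_comm' c a, mul_comm' c b]
  zero_mul := zero_mul'
  mul_zero a := (mul_comm' a 0).trans (zero_mul' a)
  mul_assoc := mul_assoc'
  one_mul := one_mul'
  mul_one a := (mul_comm' a 1).trans (one_mul' a)
  zsmul := zsmulRec
  neg_add_cancel := neg_add_cancel'
  mul_comm := mul_comm'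

end CInftyRing

/-- The weak bounded inversion property `1 + ∑ R² ⊆ Rˣ` of a commutative ring `R`, where `∑ R²` is
the set of all finite sums of squares of elements of `R`. -/
def HasWeakBoundedInversion (R : Type u) [CommRing R] : Prop :=
  ∀ s : R, IsSumSq s → IsUnit (1 + s)

/-- A `C^∞`-field is a `C^∞`-ring whose underlying ring is a field. -/
def IsCInftyField (F : Type u) [CInftyRing F] : Prop :=
  IsField F

namespace CInftyRing

variable {A : Type u} [CInftyRing A]

/-! Identities between smooth functions pass to every $C^\infty$-ring. If $f$ vanishes nowhere,
$1/f$ is smooth and $f\cdot(1/f)=1$, so every value of $f^A$ is a unit (`isUnit_op`). A sum of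
squares in $A$ is a value of $f^A$ for some smooth $f\ge 0$ (`exists_nonneg_op_eq_of_isSumSq`); then
$1+f>0$ vanishes nowhere, so $1+s$ is a unit. If $-1$ were a sum of squares, $1+(-1)=0$ would be a
unit, which is impossible in a field. -/

/-- A nowhere vanishing smooth function is interpreted by unit-valued operations. -/
theorem isUnit_op {n : ℕ} (f : SmoothFun n) (hf : ∀ x, f.1 x ≠ 0) (v : Fin n → A) :
    IsUnit (op f v) := by
  refine IsUnit.of_mul_eq_one (op (⟨fun x => (f.1 x)⁻¹, f.2.inv hf⟩ : SmoothFun n) v) ?_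
  have h := op_mul f ⟨fun x => (f.1 x)⁻¹, f.2.inv hf⟩ v
  simp only [mul_inv_cancel₀ (hf _)] at h
  exact h.trans (op_one v).symm

/-- Adding a dummy first variable does not change the value of an operation. -/
theorem op_comp_tail {n : ℕ} (f : SmoothFun n) (a : A) (v : Fin n → A) :
    op (SmoothFun.comp f fun i => SmoothFun.proj i.succ) (Fin.cons a v : Fin (n + 1) → A) =
      op f v := by
  simp only [op_comp, op_proj, Fin.cons_succ]

/-- A sum of squares is a value of the interpretation of a nonnegative smooth function. -/
theorem exists_nonneg_op_eq_of_isSumSq {s : A} (hs : IsSumSq s) :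
    ∃ (n : ℕ) (f : SmoothFun n) (v : Fin n → A), (∀ x, 0 ≤ f.1 x) ∧ op f v = s := by
  induction hs with
  -- `rfl` suffices: the zero of `A` is by definition this nullary operation.
  | zero => exact ⟨0, SmoothFun.const 0, ![], fun _ => le_rfl, rfl⟩
  | sq_add a _ ih =>
    obtain ⟨n, f, v, hf, rfl⟩ := ih
    have ha : op (SmoothFun.proj 0) (Fin.cons a v : Fin (n + 1) → A) = a := by
      rw [op_proj, Fin.cons_zero]
    refine ⟨n + 1, _, Fin.cons a v, fun x => add_nonneg (mul_self_nonneg (x 0)) (hf (Fin.tail x)),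
      ((op_add (⟨fun x => x 0 * x 0, by fun_prop⟩ : SmoothFun (n + 1))
        (SmoothFun.comp f fun i => SmoothFun.proj i.succ) _).symm.trans ?_)⟩
    rw [op_comp_tail]
    exact congrArg (· + op f v) ((op_mul (SmoothFun.proj 0) (SmoothFun.proj 0) _).symm.trans
      (congrArg₂ (· * ·) ha ha))

theorem hasWeakBoundedInversion (A : Type u) [CInftyRing A] : HasWeakBoundedInversion A := by
  intro s hs
  obtain ⟨n, f, v, hf, rfl⟩ := exists_nonneg_op_eq_of_isSumSq hs
  -- Reading `1` as the constant function in the same variables makes $1+s$ the value of $1+f$ at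
  -- `v`.
  rw [op_one v, op_add]
  exact isUnit_op _ (fun x => (add_pos_of_pos_of_nonneg one_pos (hf x)).ne') v

end CInftyRing

/-- In a nontrivial ring with weak bounded inversion, `-1` is not a sum of squares. -/
theorem HasWeakBoundedInversion.not_isSumSq_neg_one {R : Type u} [CommRing R] [Nontrivial R]
    (h : HasWeakBoundedInversion R) : ¬ IsSumSq (-1 : R) := fun hs =>
  not_isUnit_zero (add_neg_cancel (1 : R) ▸ h (-1) hs)

theorem corollary3p16 :
    (∀ (A : Type u) [CInftyRing A], HasWeakBoundedInversion A) ∧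
    (∀ (F : Type u) [CInftyRing F], IsCInftyField F → ¬ IsSumSq (-1 : F)) := by
  refine ⟨fun A _ => CInftyRing.hasWeakBoundedInversion A, fun F _ hF => ?_⟩
  have : Nontrivial F := IsField.nontrivial hF
  exact (CInftyRing.hasWeakBoundedInversion F).not_isSumSq_neg_one
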